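/- **Setting.** Let $\mathbb T=(T,\mu,\eta)$ be a monad on $\mathbf{Set}$ and let $f\circledcirc g=\mu_X\circ Tg\circ f$ denote Kleisli composition of $f,g\colon X\to TX$. Assume that every $TX$ carries a sup-lattice structure (all joins, including the empty join $\bot_{TX}$) and that $\mathbb T$ is *left-quantalic* with respect to it: $f\circledcirc\bigvee_i g_i=\bigvee_i (f\circledcirc g_i)$ for all sets $X$, all $f\colon X\to TX$ and all families of maps $g_i\colon X\to TX$, joins of maps being pointwise. Put $f^{[0]}=\eta_X$, $f^{[n+1]}=f\circledcirc f^{[n]}$ and $f^*=\bigvee_{n<\omega}f^{[n]}$. Let $\mathcal N$ be the neighbourhood monad, $\mathcal N X=\mathcal P(\mathcal P(X))$, $\eta^{\mathcal N}_X(x)=\{U\mid x\in U\}$, $\mathcal N f(N)=\{V\mid f^{-1}(V)\in N\}$, $\mu^{\mathcal N}_X(W)=\{U\mid\{N\mid U\in N\}\in W\}$. Let $\lambda_X\colon\mathcal P(X)\to\mathcal P(TX)$ be a predicate lifting (natural with respect to inverse images) that is monotone ($U\subseteq V$ implies $\lambda_X(U)\subseteq\lambda_X(V)$), *diamond-like*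 ($\bigvee_i t_i\in\lambda_X(U)$ iff $t_i\in\lambda_X(U)$ for some $i$, for all families, the empty one included), and whose transpose $\hat\lambda\colon T\Rightarrow\mathcal N$, $\hat\lambda_X(t)=\{U\mid t\in\lambda_X(U)\}$, is a monad morphism. Let $\Sigma$ be a signature of finitary operation symbols. For each $n$-ary $\underline\sigma\in\Sigma$ let natural transformations $\sigma\colon T^n\Rightarrow T$ and $\chi\colon\mathcal N^n\Rightarrow\mathcal N$ with $\hat\lambda\circ\sigma=\chi\circ\hat\lambda^n$ be given; $\theta$ denotes the collection of the $\sigma$. Let $2=\{0,1\}$. By the Yoneda lemma $\chi$ corresponds to an element $\check\chi$ of the free Boolean algebra $\mathcal P(\mathcal P(G))$ on the finite set of generators $G=\{1,\dots,n\}\times\mathcal P(2)$: a set $S\subseteq G$ belongs to $\check\chi$ iff $\{1\}\in\chi_2(N_1,\dots,N_n)$, where $N_i=\{V\subseteq 2\mid (i,V)\in S\}$. Fix a Boolean expression denoting $\check\chi$; for actions $\alpha_1,\dots,\alpha_n$ and an atomic proposition $p$ let $\varphi_\chi(\alpha_1,\dots,\alpha_n)$ be the formula obtained from it by replacing each generator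 $(i,V)$ by $\langle\alpha_i\rangle V(p)$, where $V(p)$ is $\top,p,\neg p,\bot$ for $V=\{0,1\},\{1\},\{0\},\emptyset$ respectively. The operation $\sigma$ is *positive* if $\check\chi$ can be obtained from generators using only (binary) $\wedge$ and $\vee$. **Syntax and semantics.** Let $P$ be an infinite set of atomic propositions and $A_0$ a set of atomic actions. Dynamic formulas and actions are given by $$\varphi::=p\mid\bot\mid\neg\varphi\mid\varphi\wedge\varphi\mid\langle\alpha\rangle\varphi,\qquad \alpha::=a\mid\alpha;\alpha\mid\underline\sigma(\alpha_1,\dots,\alpha_n)\mid\alpha^*\mid\varphi?\qquad(p\in P,\ a\in A_0,\ \underline\sigma\in\Sigma).$$ A *$\theta$-dynamic $\mathbb T$-model* is a set $X$ with maps $\gamma_0(a)\colon X\to TX$ ($a\in A_0$) and a valuation $V\colon P\to\mathcal P(X)$. Actions are interpreted as maps $\gamma(\alpha)\colon X\to TX$ and formulas as subsets of $X$ by mutual recursion: $\gamma(a)=\gamma_0(a)$; $\gamma(\alpha;\beta)=\gamma(\alpha)\circledcirc\gamma(\beta)$; $\gamma(\underline\sigma(\alpha_1,\dots,\alpha_n))(x)=\sigma_X(\gamma(\alpha_1)(x),\dots,\gamma(\alpha_n)(x))$;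 $\gamma(\alpha^*)=\gamma(\alpha)^*$; $\gamma(\varphi?)(x)=\eta_X(x)$ if $x\in[\![\varphi]\!]$ and $\bot_{TX}$ otherwise; $[\![p]\!]=V(p)$, the Boolean connectives are interpreted as usual, and $[\![\langle\alpha\rangle\varphi]\!]=\{x\mid\gamma(\alpha)(x)\in\lambda_X([\![\varphi]\!])\}$. **The logics.** The base logic $\mathcal L_\Diamond=(\{\Diamond\},\mathrm{Ax},\emptyset,\mathrm{Ru})$ consists of a set $\mathrm{Ax}$ of rank-1 axioms (propositional combinations of formulas $\Diamond\pi$ with $\pi$ a propositional formula over $P$) and a set $\mathrm{Ru}$ of one-premise rules between formulas of the basic modal language over $P$, which contains the congruence rule (from $\varphi\leftrightarrow\psi$ infer $\Diamond\varphi\leftrightarrow\Diamond\psi$). For a set $X$, consider propositional combinations of expressions $\Diamond U$, $U\subseteq X$. Such a formula is *one-step derivable* if it is propositionally entailed by the formulas $\psi\tau$ with $\psi\in\mathrm{Ax}$ and $\tau\colon P\to\mathcal P(X)$ (inner propositional formulas being evaluated in $\mathcal P(X)$). A set of such formulas is *one-step consistent* if the negation of no finite conjunction of its members is one-step derivable,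 and *one-step satisfiable* if some $t\in TX$ satisfies all its members, where $t$ satisfies $\Diamond U$ iff $t\in\lambda_X(U)$. $\mathcal L_\Diamond$ is *one-step complete* if for every finite set $X$ every one-step consistent set is one-step satisfiable. The *$\theta$-dynamic logic* $\mathcal L=\mathcal L(\theta,;,{}^*,?)$ over $\mathcal L_\Diamond$ has as derivable formulas the smallest set of dynamic formulas that contains all propositional tautologies and the following axioms, for all actions $\alpha,\beta,\alpha_i$, all dynamic formulas $\psi$ and all $p\in P$: every axiom in $\mathrm{Ax}$ with $\langle\alpha\rangle$ in place of $\Diamond$; $$\langle\underline\sigma(\alpha_1,\dots,\alpha_n)\rangle p\leftrightarrow\varphi_\chi(\alpha_1,\dots,\alpha_n),\quad \langle\alpha;\beta\rangle p\leftrightarrow\langle\alpha\rangle\langle\beta\rangle p,\quad \langle\alpha^*\rangle p\leftrightarrow p\vee\langle\alpha\rangle\langle\alpha^*\rangle p,\quad \langle\psi?\rangle p\leftrightarrow(\psi\wedge p);$$ and is closed under modus ponens, uniform substitution of formulas for atomic propositions (also inside the tests occurring in modalities), and all substitution instances of the following rules: the rules in $\mathrm{Ru}$ with $\langle\alpha\rangle$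 in place of $\Diamond$, the congruence rule for each $\langle\alpha\rangle$, and the rule "from $\langle\alpha\rangle\psi\vee\varphi\to\psi$ infer $\langle\alpha^*\rangle\varphi\to\psi$". A formula $\varphi$ is *$\mathcal L$-consistent* if $\neg\varphi$ is not derivable. **Theorem.** Suppose that $\mathcal L_\Diamond$ is one-step complete with respect to $T$ and $\lambda$, and that every operation in $\theta$ is positive. Then $\mathcal L(\theta,;,{}^*,?)$ is weakly complete with respect to the class of all $\theta$-dynamic $\mathbb T$-models: every $\mathcal L$-consistent formula $\varphi$ is satisfiable, i.e. $x\in[\![\varphi]\!]$ for some state $x$ of some $\theta$-dynamic $\mathbb T$-model (equivalently, every formula valid in all these models is derivable). -/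

import Mathlib

universe u v

namespace CDL

/-! ### Propositional formulas -/

/-- `Prop(X)`: propositional formulas over a set of generators `X`. -/
inductive PForm (X : Type*) : Type _
  | atom : X → PForm X
  | top : PForm X
  | neg : PForm X → PForm X
  | and : PForm X → PForm X → PForm X

namespace PForm

def bot {X : Type*} : PForm X := neg top

def or {X : Type*} (φ ψ : PForm X) : PForm X := neg (and (neg φ) (neg ψ))

def imp {X : Type*} (φ ψ : PForm X) : PForm X := neg (and φ (neg ψ))

/-- Finite conjunctions. -/
def bigAnd {X : Type*} : List (PForm X) → PForm X
  | [] => top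
  | φ :: l => and φ (bigAnd l)

/-- Truth of a propositional formula under a valuation of the generators. -/
def eval {X : Type*} (w : X → Prop) : PForm X → Prop
  | atom x => w x
  | top => True
  | neg φ => ¬ eval w φ
  | and φ ψ => eval w φ ∧ eval w ψ

/-- Replacement of the generators. -/
def map {X Y : Type*} (f : X → Y) : PForm X → PForm Y
  | atom x => atom (f x)
  | top => top
  | neg φ => neg (map f φ)
  | and φ ψ => and (map f φ) (map f ψ)

/-- Value of a propositional formula in the Boolean algebra `𝒫(Y)`, for generators that are
interpreted as subsets of `Y`. -/
def setEval {X Y : Type*} (τ : X → Set Y) (φ : PForm X) : Set Y :=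
  {y | φ.eval fun x => y ∈ τ x}

end PForm

/-! ### The neighbourhood monad -/

/-- The neighbourhood monad `𝒩 X = 𝒫(𝒫(X))`. -/
def Nbhd (X : Type u) : Type u := Set (Set X)

instance (X : Type u) : Membership (Set X) (Nbhd X) :=
  inferInstanceAs (Membership (Set X) (Set (Set X)))

/-- The unit is `x ↦ {U | x ∈ U}`. The functor maps `f` to `𝒰 ↦ {V | f⁻¹(V) ∈ 𝒰}` and the
multiplication is `W ↦ {U | {𝒰 | U ∈ 𝒰} ∈ W}`; thus `μ (𝒩 f 𝒰) = {U | {x | U ∈ f x} ∈ 𝒰}`. -/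
instance : Monad Nbhd.{u} where
  pure x := ({U | x ∈ U} : Set (Set _))
  map f N := ({V | f ⁻¹' V ∈ N} : Set (Set _))
  bind N f := ({U | {x | U ∈ f x} ∈ N} : Set (Set _))

instance : LawfulMonad Nbhd.{u} :=
  LawfulMonad.mk' (m := Nbhd.{u})
    (id_map := fun _ => rfl)
    (pure_bind := fun _ _ => rfl)
    (bind_assoc := fun _ _ _ => rfl)
    (bind_pure_comp := fun _ _ => rfl)

/-! ### Predicate liftings and left-quantalic monads -/

/-- A (unary) predicate lifting `λ : 𝒬 ⇒ 𝒬 ∘ T`, with `𝒬` the contravariant powerset functor. -/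
structure PredLift (T : Type u → Type u) [Monad T] where
  app : ∀ {X : Type u}, Set X → Set (T X)
  naturality : ∀ {X Y : Type u} (f : X → Y) (U : Set Y),
    app (f ⁻¹' U) = {t : T X | f <$> t ∈ app U}

/-- The transpose `λ̂ : T ⇒ 𝒩`. -/
def PredLift.transpose {T : Type u → Type u} [Monad T] (lam : PredLift T) {X : Type u}
    (t : T X) : Nbhd X :=
  ({U | t ∈ lam.app U} : Set (Set X))

/-- A family of maps `T X → T' X` is a morphism of monads: it preserves the unit and Kleisli
extension (equivalently: it is natural and preserves unit and multiplication). -/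
structure IsMonadMorphism {T T' : Type u → Type u} [Monad T] [Monad T']
    (h : ∀ {X : Type u}, T X → T' X) : Prop where
  map_pure : ∀ {X : Type u} (x : X), h (pure x : T X) = pure x
  map_bind : ∀ {X Y : Type u} (t : T X) (f : X → T Y),
    h (t >>= f) = h t >>= fun x => h (f x)

/-- `λ` is monotone. -/
def PredLift.Monotonic {T : Type u → Type u} [Monad T] (lam : PredLift T) : Prop :=
  ∀ (X : Type u) (U V : Set X), U ⊆ V → lam.app U ⊆ lam.app V

/-- Kleisli composition in diagrammatic order: `(f ⊚ g)(x) = μ (T g (f x))`. -/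
def kcomp {T : Type u → Type u} [Monad T] {X : Type u} (f g : X → T X) : X → T X :=
  fun x => f x >>= g

/-- Iterated Kleisli composition: `f^[0] = η`, `f^[n+1] = f ⊚ f^[n]`. -/
def kpow {T : Type u → Type u} [Monad T] {X : Type u} (f : X → T X) : ℕ → X → T X
  | 0 => fun x => pure x
  | n + 1 => kcomp f (kpow f n)

/-- Pointwise join of a set of Kleisli endomorphisms. -/
def kJoin {T : Type u → Type u} [∀ X : Type u, CompleteSemilatticeSup (T X)] {X : Type u}
    (G : Set (X → T X)) : X → T X :=
  fun x => sSup {t | ∃ g ∈ G, t = g x}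

/-- Kleisli iteration `f^* = ⋁ₙ f^[n]`. -/
def kstar {T : Type u → Type u} [Monad T] [∀ X : Type u, CompleteSemilatticeSup (T X)]
    {X : Type u} (f : X → T X) : X → T X :=
  kJoin (Set.range (kpow f))

/-- The given sup-lattice structures on the sets `T X` make the monad `T` left-quantalic:
Kleisli composition left-distributes over the pointwise joins in `Kl(T)(X, X)`,
`f ⊚ ⋁ᵢ gᵢ = ⋁ᵢ (f ⊚ gᵢ)`. -/
def LeftQuantalic (T : Type u → Type u) [Monad T]
    [∀ X : Type u, CompleteSemilatticeSup (T X)] : Prop :=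
  ∀ (X : Type u) (f : X → T X) (G : Set (X → T X)),
    kcomp f (kJoin G) = kJoin {h | ∃ g ∈ G, h = kcomp f g}

/-- `λ` is diamond-like: `⋁ᵢ tᵢ ∈ λ(U)` iff `tᵢ ∈ λ(U)` for some `i`. -/
def PredLift.DiamondLike {T : Type u → Type u} [Monad T]
    [∀ X : Type u, CompleteSemilatticeSup (T X)] (lam : PredLift T) : Prop :=
  ∀ (X : Type u) (U : Set X) (s : Set (T X)), sSup s ∈ lam.app U ↔ ∃ t ∈ s, t ∈ lam.app U

/-! ### Natural operations and pointwise operations -/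

/-- A natural operation `Fⁿ ⇒ F`. -/
structure NatOp (F : Type u → Type u) [Functor F] (n : ℕ) where
  app : ∀ {X : Type u}, (Fin n → F X) → F X
  naturality : ∀ {X Y : Type u} (f : X → Y) (t : Fin n → F X),
    app (fun i => f <$> t i) = f <$> app t

/-- The two-element set `2 = {0, 1}`. -/
abbrev Two : Type u := ULift.{u} Bool

/-- The set `n · 𝒬(2)` of generators; `(i, V)` is `V ⊆ 2` in the `i`-th copy. -/
abbrev Gen (n : ℕ) : Type u := Fin n × Set Two.{u}

/-- The element of `𝒩(n · 𝒬(2))` (the free Boolean algebra on the finite set `n · 𝒬(2)`) that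
corresponds to `χ : 𝒩ⁿ ⇒ 𝒩` under the Yoneda lemma. A subset `S` of `n · 𝒬(2)` is the same thing
as an element of `(𝒩 2)ⁿ`, and `S` belongs to the element iff `{1} ∈ χ₂(S)`. -/
def NatOp.yon {n : ℕ} (χ : NatOp Nbhd.{u} n) : Set (Set (Gen.{u} n)) :=
  {S | ({ULift.up true} : Set Two.{u}) ∈
    χ.app (X := Two.{u}) fun i => ({V | (i, V) ∈ S} : Set (Set Two.{u}))}

/-- The elements of the free Boolean algebra `𝒫(𝒫(G))` on a finite set `G` that are constructed
from the generators using only `∧` and `∨`. -/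
inductive PosGenerated {G : Type*} : Set (Set G) → Prop
  | gen (g : G) : PosGenerated {S | g ∈ S}
  | and {a b : Set (Set G)} : PosGenerated a → PosGenerated b → PosGenerated (a ∩ b)
  | or {a b : Set (Set G)} : PosGenerated a → PosGenerated b → PosGenerated (a ∪ b)

/-- The interpretation of an `n`-ary operation symbol: natural operations `σ : Tⁿ ⇒ T` and
`χ : 𝒩ⁿ ⇒ 𝒩` with `λ̂ ∘ σ = χ ∘ λ̂ⁿ`, together with a Boolean expression `expr` over the generators
that denotes the Yoneda element of `χ` (from which the axiom for the symbol is read off). -/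
structure PointwiseOp {T : Type u → Type u} [Monad T] (lam : PredLift T) (n : ℕ) where
  σ : NatOp T n
  χ : NatOp Nbhd.{u} n
  comm : ∀ {X : Type u} (t : Fin n → T X),
    lam.transpose (σ.app t) = χ.app fun i => lam.transpose (t i)
  expr : PForm (Gen.{u} n)
  expr_denotes : {S : Set (Gen.{u} n) | expr.eval fun g => g ∈ S} = χ.yon

def PointwiseOp.Positive {T : Type u → Type u} [Monad T] {lam : PredLift T} {n : ℕ}
    (o : PointwiseOp lam n) : Prop :=
  PosGenerated o.χ.yon

/-! ### The base modal logic and one-step completeness -/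

/-- Formulas of the basic modal language `Fm({◇}, P)`. -/
inductive BFm (P : Type*) : Type _
  | atom : P → BFm P
  | top : BFm P
  | neg : BFm P → BFm P
  | and : BFm P → BFm P → BFm P
  | dia : BFm P → BFm P

def BFm.iff {P : Type*} (φ ψ : BFm P) : BFm P :=
  .and (.neg (.and φ (.neg ψ))) (.neg (.and ψ (.neg φ)))

/-- A modal logic `({◇}, Ax, ∅, Ru)` over the basic modal language without frame conditions.
Rank-1 axioms are elements of `Prop({◇}(Prop(P)))`: an outer generator `π` stands for `◇π`.
A rule `(φ, ψ)` has premise `φ` and conclusion `ψ`. -/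
structure BaseLogic (P : Type*) where
  ax : Set (PForm (PForm P))
  rules : Set (BFm P × BFm P)
  congruence : ∀ φ ψ : BFm P, (φ.iff ψ, (BFm.dia φ).iff (BFm.dia ψ)) ∈ rules

namespace BaseLogic

variable {P : Type*} (L : BaseLogic P)

/-- One-step derivability of a formula in `Prop({◇}(𝒫(X)))` (a generator `U` stands for `◇U`):
propositional entailment from the formulas `ψτ`, for `ψ ∈ Ax` and `τ : P → 𝒫(X)`. -/
def OneStepDerivable {X : Type u} (φ : PForm (Set X)) : Prop :=
  ∀ w : Set X → Prop,
    (∀ ψ ∈ L.ax, ∀ τ : P → Set X, (ψ.map (PForm.setEval τ)).eval w) → φ.eval w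

/-- One-step consistency of a set of formulas. -/
def OneStepConsistent {X : Type u} (Φ : Set (PForm (Set X))) : Prop :=
  ¬ ∃ l : List (PForm (Set X)), (∀ φ ∈ l, φ ∈ Φ) ∧
    L.OneStepDerivable ((PForm.bigAnd l).imp PForm.bot)

end BaseLogic

/-- One-step semantics: `⟦◇U⟧ = λ(U) ⊆ T X`, extended to Boolean combinations. -/
def oneStepSem {T : Type u → Type u} [Monad T] (lam : PredLift T) {X : Type u}
    (φ : PForm (Set X)) : Set (T X) :=
  φ.setEval fun U => lam.app U

/-- One-step completeness with respect to the semantics given by `T` and `λ`: over every finite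
set, every one-step consistent set of formulas is one-step satisfiable. -/
def BaseLogic.OneStepComplete {P : Type*} (L : BaseLogic P) {T : Type u → Type u} [Monad T]
    (lam : PredLift T) : Prop :=
  ∀ (X : Type u) [Finite X] (Φ : Set (PForm (Set X))), L.OneStepConsistent Φ →
    ∃ t : T X, ∀ φ ∈ Φ, t ∈ oneStepSem lam φ

/-! ### Dynamic formulas and actions -/

mutual

/-- Dynamic formulas over atomic propositions `P`, atomic actions `A` and a signature of operation
symbols `Sig` with arities `ar`. -/
inductive Fm (P A Sig : Type v) (ar : Sig → ℕ) : Type v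
  | atom : P → Fm P A Sig ar
  | bot : Fm P A Sig ar
  | neg : Fm P A Sig ar → Fm P A Sig ar
  | and : Fm P A Sig ar → Fm P A Sig ar → Fm P A Sig ar
  | mod : Act P A Sig ar → Fm P A Sig ar → Fm P A Sig ar

/-- Complex actions. -/
inductive Act (P A Sig : Type v) (ar : Sig → ℕ) : Type v
  | atom : A → Act P A Sig ar
  | comp : Act P A Sig ar → Act P A Sig ar → Act P A Sig ar
  | op : (s : Sig) → (Fin (ar s) → Act P A Sig ar) → Act P A Sig ar
  | star : Act P A Sig ar → Act P A Sig ar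
  | test : Fm P A Sig ar → Act P A Sig ar

end

section Syn

variable {P A Sig : Type v} {ar : Sig → ℕ}

namespace Fm

def top : Fm P A Sig ar := neg bot

def or (φ ψ : Fm P A Sig ar) : Fm P A Sig ar := neg (and (neg φ) (neg ψ))

def imp (φ ψ : Fm P A Sig ar) : Fm P A Sig ar := neg (and φ (neg ψ))

def iff (φ ψ : Fm P A Sig ar) : Fm P A Sig ar := and (imp φ ψ) (imp ψ φ)

/-- Propositional tautologies: true under every Boolean valuation that treats atomic propositions
and modal formulas as propositional variables. -/
def Tautology (φ : Fm P A Sig ar) : Prop :=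
  ∀ w : Fm P A Sig ar → Prop, ¬ w bot → (∀ ψ, w (neg ψ) ↔ ¬ w ψ) →
    (∀ ψ χ, w (and ψ χ) ↔ w ψ ∧ w χ) → w φ

end Fm

mutual

/-- Uniform substitution of formulas for atomic propositions, everywhere in a formula (that is,
also in the tests that occur inside modalities). -/
def Fm.subst (s : P → Fm P A Sig ar) : Fm P A Sig ar → Fm P A Sig ar
  | .atom p => s p
  | .bot => .bot
  | .neg φ => .neg (Fm.subst s φ)
  | .and φ ψ => .and (Fm.subst s φ) (Fm.subst s ψ)
  | .mod α φ => .mod (Act.subst s α) (Fm.subst s φ)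

/-- Uniform substitution in actions. -/
def Act.subst (s : P → Fm P A Sig ar) : Act P A Sig ar → Act P A Sig ar
  | .atom a => .atom a
  | .comp α β => .comp (Act.subst s α) (Act.subst s β)
  | .op f α => .op f fun i => Act.subst s (α i)
  | .star α => .star (Act.subst s α)
  | .test φ => .test (Fm.subst s φ)

end

/-- A propositional formula with formulas in place of its generators, as a dynamic formula. -/
def PForm.toFm {X : Type*} (f : X → Fm P A Sig ar) : PForm X → Fm P A Sig ar
  | .atom x => f x
  | .top => Fm.top
  | .neg φ => .neg (PForm.toFm f φ)
  | .and φ ψ => .and (PForm.toFm f φ) (PForm.toFm f ψ)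

/-- The rank-1 axiom `ψ` with `⟨α⟩` substituted for `◇`. -/
def labelAx (α : Act P A Sig ar) (ψ : PForm (PForm P)) : Fm P A Sig ar :=
  ψ.toFm fun π => .mod α (π.toFm .atom)

/-- The formula `φ` with `⟨α⟩` substituted for `◇`. -/
def BFm.label (α : Act P A Sig ar) : BFm P → Fm P A Sig ar
  | .atom p => .atom p
  | .top => Fm.top
  | .neg φ => .neg (BFm.label α φ)
  | .and φ ψ => .and (BFm.label α φ) (BFm.label α ψ)
  | .dia φ => .mod α (BFm.label α φ)

open Classical in
/-- The Boolean combination of `φ` described by `V ⊆ 2`: `{0,1} ↦ ⊤`, `{1} ↦ φ`, `{0} ↦ ¬φ`,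
`∅ ↦ ⊥`. -/
noncomputable def boolComb (V : Set Two.{u}) (φ : Fm P A Sig ar) : Fm P A Sig ar :=
  if ULift.up true ∈ V then
    if ULift.up false ∈ V then Fm.top else φ
  else
    if ULift.up false ∈ V then .neg φ else .bot

/-- The rank-1 formula obtained from a Boolean expression over the generators `n · 𝒬(2)` by
reading the generator `(i, V)` as `⟨αᵢ⟩V(p)`. -/
noncomputable def pwFormula {n : ℕ} (e : PForm (Gen.{u} n)) (α : Fin n → Act P A Sig ar) (p : P) :
    Fm P A Sig ar :=
  e.toFm fun g => .mod (α g.1) (boolComb g.2 (.atom p))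

/-- The derivable formulas of the logic with axioms `Ax`, frame conditions `Fr` and rules `Ru`. -/
inductive Derivable (Ax Fr : Set (Fm P A Sig ar)) (Ru : Set (Fm P A Sig ar × Fm P A Sig ar)) :
    Fm P A Sig ar → Prop
  | ax {φ} : φ ∈ Ax → Derivable Ax Fr Ru φ
  | fr {φ} : φ ∈ Fr → Derivable Ax Fr Ru φ
  | taut {φ} : φ.Tautology → Derivable Ax Fr Ru φ
  | mp {φ ψ} : Derivable Ax Fr Ru (φ.imp ψ) → Derivable Ax Fr Ru φ → Derivable Ax Fr Ru ψ
  | subst {φ} (s : P → Fm P A Sig ar) : Derivable Ax Fr Ru φ → Derivable Ax Fr Ru (φ.subst s)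
  | rule {φ ψ} (s : P → Fm P A Sig ar) : (φ, ψ) ∈ Ru →
      Derivable Ax Fr Ru (φ.subst s) → Derivable Ax Fr Ru (ψ.subst s)

/-! ### The dynamic logic -/

/-- All labelled instances `Ax_α` of the axioms of the base logic, together with the axioms
`⟨σ(α₁,…,αₙ)⟩p ↔ φ(χ, α₁,…,αₙ)` for the operation symbols. -/
def dynAx {T : Type u → Type u} [Monad T] {lam : PredLift T} (L : BaseLogic P)
    (θ : ∀ s : Sig, PointwiseOp lam (ar s)) : Set (Fm P A Sig ar) :=
  {φ | ∃ α : Act P A Sig ar, ∃ ψ ∈ L.ax, φ = labelAx α ψ} ∪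
  {φ | ∃ (s : Sig) (α : Fin (ar s) → Act P A Sig ar) (p : P),
    φ = (Fm.mod (.op s α) (.atom p)).iff (pwFormula (θ s).expr α p)}

/-- The frame conditions: the axioms for composition, iteration and tests. -/
def dynFr : Set (Fm P A Sig ar) :=
  {φ | ∃ (α β : Act P A Sig ar) (p : P),
    φ = (Fm.mod (.comp α β) (.atom p)).iff (.mod α (.mod β (.atom p)))} ∪
  {φ | ∃ (α : Act P A Sig ar) (p : P),
    φ = (Fm.mod (.star α) (.atom p)).iff
      ((Fm.atom p).or (.mod α (.mod (.star α) (.atom p))))} ∪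
  {φ | ∃ (ψ : Fm P A Sig ar) (p : P),
    φ = (Fm.mod (.test ψ) (.atom p)).iff (.and ψ (.atom p))}

/-- The rules: all labelled instances of the rules of the base logic, among them the congruence
rule for every modality `⟨α⟩` (for arbitrary dynamic formulas), and the rule
`⟨α⟩ψ ∨ φ → ψ / ⟨α^*⟩φ → ψ`. -/
def dynRules (L : BaseLogic P) : Set (Fm P A Sig ar × Fm P A Sig ar) :=
  {r | ∃ α : Act P A Sig ar, ∃ b ∈ L.rules, r = (b.1.label α, b.2.label α)} ∪
  {r | ∃ (α : Act P A Sig ar) (φ ψ : Fm P A Sig ar),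
    r = (φ.iff ψ, (Fm.mod α φ).iff (.mod α ψ))} ∪
  {r | ∃ (α : Act P A Sig ar) (φ ψ : Fm P A Sig ar),
    r = (((Fm.mod α ψ).or φ).imp ψ, (Fm.mod (.star α) φ).imp ψ)}

/-- Derivability in the `θ`-dynamic logic `𝓛(θ, ;, *, ?)` over the base logic `L`. -/
def DynDerivable {T : Type u → Type u} [Monad T] {lam : PredLift T} (L : BaseLogic P)
    (θ : ∀ s : Sig, PointwiseOp lam (ar s)) (φ : Fm P A Sig ar) : Prop :=
  Derivable (dynAx L θ) dynFr (dynRules L) φ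

/-- `φ` is consistent if `¬φ` is not derivable. -/
def DynConsistent {T : Type u → Type u} [Monad T] {lam : PredLift T} (L : BaseLogic P)
    (θ : ∀ s : Sig, PointwiseOp lam (ar s)) (φ : Fm P A Sig ar) : Prop :=
  ¬ DynDerivable L θ φ.neg

/-! ### Dynamic models -/

/-- The data of a dynamic model on a set `X` (the predicate lifting being fixed): an interpretation
of the atomic actions and a valuation of the atomic propositions. -/
structure DynModel (T : Type u → Type u) (P A : Type v) (X : Type u) where
  γ₀ : A → X → T X
  val : P → Set X

section Sem

variable {T : Type u → Type u} [Monad T] [∀ X : Type u, CompleteSemilatticeSup (T X)]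
  {lam : PredLift T}

open Classical in
/-- The test action for `U ⊆ X`: `η(x)` if `x ∈ U`, and the empty join otherwise. -/
noncomputable def testAct {X : Type u} (U : Set X) : X → T X :=
  fun x => if x ∈ U then pure x else sSup ∅

mutual

/-- Truth sets of dynamic formulas. -/
noncomputable def DynModel.truth (θ : ∀ s : Sig, PointwiseOp lam (ar s)) {X : Type u}
    (M : DynModel T P A X) : Fm P A Sig ar → Set X
  | .atom p => M.val p
  | .bot => ∅
  | .neg φ => (DynModel.truth θ M φ)ᶜ
  | .and φ ψ => DynModel.truth θ M φ ∩ DynModel.truth θ M ψ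
  | .mod α φ => {x | DynModel.act θ M α x ∈ lam.app (DynModel.truth θ M φ)}

/-- The semantics of complex actions. -/
noncomputable def DynModel.act (θ : ∀ s : Sig, PointwiseOp lam (ar s)) {X : Type u}
    (M : DynModel T P A X) : Act P A Sig ar → X → T X
  | .atom a => M.γ₀ a
  | .comp α β => kcomp (DynModel.act θ M α) (DynModel.act θ M β)
  | .op s α => fun x => (θ s).σ.app fun i => DynModel.act θ M (α i) x
  | .star α => kstar (DynModel.act θ M α)
  | .test φ => testAct (DynModel.truth θ M φ)

end

/-- `φ` is satisfiable: it is true at some state of some `θ`-dynamic `T`-model. -/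
def DynSatisfiable (θ : ∀ s : Sig, PointwiseOp lam (ar s)) (φ : Fm P A Sig ar) : Prop :=
  ∃ (X : Type u) (M : DynModel T P A X) (x : X), x ∈ M.truth θ φ

end Sem

end Syn

end CDL

namespace CDL

section Substitution

variable {P A Sig : Type v} {ar : Sig → ℕ}

mutual

theorem Fm.subst_atom : ∀ φ : Fm P A Sig ar, φ.subst .atom = φ
  | .atom _ => rfl
  | .bot => rfl
  | .neg φ => by rw [Fm.subst, Fm.subst_atom φ]
  | .and φ ψ => by rw [Fm.subst, Fm.subst_atom φ, Fm.subst_atom ψ]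
  | .mod α φ => by rw [Fm.subst, Act.subst_atom α, Fm.subst_atom φ]

theorem Act.subst_atom : ∀ α : Act P A Sig ar, α.subst .atom = α
  | .atom _ => rfl
  | .comp α β => by rw [Act.subst, Act.subst_atom α, Act.subst_atom β]
  | .op s α => by
      rw [Act.subst]
      exact congrArg (Act.op s) (funext fun i => Act.subst_atom (α i))
  | .star α => by rw [Act.subst, Act.subst_atom α]
  | .test φ => by rw [Act.subst, Fm.subst_atom φ]

end

mutual

theorem Fm.subst_subst (s t : P → Fm P A Sig ar) :
    ∀ φ : Fm P A Sig ar, (φ.subst s).subst t = φ.subst fun p => (s p).subst t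
  | .atom _ => by simp only [Fm.subst]
  | .bot => by simp only [Fm.subst]
  | .neg φ => by simp only [Fm.subst, Fm.subst_subst s t φ]
  | .and φ ψ => by simp only [Fm.subst, Fm.subst_subst s t φ, Fm.subst_subst s t ψ]
  | .mod α φ => by simp only [Fm.subst, Act.subst_subst s t α, Fm.subst_subst s t φ]

theorem Act.subst_subst (s t : P → Fm P A Sig ar) :
    ∀ α : Act P A Sig ar, (α.subst s).subst t = α.subst fun p => (s p).subst t
  | .atom _ => by simp only [Act.subst]
  | .comp α β => by simp only [Act.subst, Act.subst_subst s t α, Act.subst_subst s t β]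
  | .op f α => by
      simp only [Act.subst]
      exact congrArg (Act.op f) (funext fun i => Act.subst_subst s t (α i))
  | .star α => by simp only [Act.subst, Act.subst_subst s t α]
  | .test φ => by simp only [Act.subst, Fm.subst_subst s t φ]

end

/-- The atomic propositions can be renamed injectively to avoid a finite set `Q`; the renaming is
undone by a substitution that can be prescribed on `Q`. -/
theorem exists_renaming [Infinite P] {Q : Set P} (hQ : Q.Finite) (s₀ : P → Fm P A Sig ar) :
    ∃ r s : P → Fm P A Sig ar, (∀ q ∈ Q, s q = s₀ q) ∧
      (∀ φ : Fm P A Sig ar, (φ.subst r).subst s = φ) ∧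
      ∀ α : Act P A Sig ar, (α.subst r).subst s = α := by
  classical
  obtain ⟨e⟩ : Nonempty (P ≃ (Qᶜ : Set P)) := by
    refine Cardinal.eq.1 (Cardinal.mk_compl_of_infinite Q ?_).symm
    exact (Cardinal.lt_aleph0_iff_set_finite.2 hQ).trans_le (Cardinal.aleph0_le_mk P)
  let s : P → Fm P A Sig ar := fun q =>
    if h : q ∈ Q then s₀ q else .atom (e.symm ⟨q, h⟩)
  have hs : ∀ p, (Fm.atom (e p : P) : Fm P A Sig ar).subst s = .atom p := fun p => by
    have h : (e p : P) ∉ Q := (e p).2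
    simp [Fm.subst, s, h]
  refine ⟨fun p => .atom (e p), s, fun q hq => by simp [s, hq], fun φ => ?_, fun α => ?_⟩
  · simp only [Fm.subst_subst, hs, Fm.subst_atom]
  · simp only [Act.subst_subst, hs, Act.subst_atom]

theorem PForm.subst_toFm {X : Type*} (f : X → Fm P A Sig ar) (s : P → Fm P A Sig ar)
    (e : PForm X) : (e.toFm f).subst s = e.toFm fun x => (f x).subst s := by
  induction e with
  | atom x => rfl
  | top => simp only [PForm.toFm, Fm.top, Fm.subst]
  | neg φ ih => simp only [PForm.toFm, Fm.subst, ih]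
  | and φ ψ ih ih' => simp only [PForm.toFm, Fm.subst, ih, ih']

theorem boolComb_subst (V : Set Two.{u}) (φ : Fm P A Sig ar) (s : P → Fm P A Sig ar) :
    (boolComb V φ).subst s = boolComb V (φ.subst s) := by
  unfold boolComb
  split_ifs <;> simp only [Fm.top, Fm.subst]

/-- The generators that occur in a propositional formula. -/
def PForm.gens {X : Type*} : PForm X → Set X
  | .atom x => {x}
  | .top => ∅
  | .neg φ => φ.gens
  | .and φ ψ => φ.gens ∪ ψ.gens

theorem PForm.finite_gens {X : Type*} : ∀ e : PForm X, e.gens.Finite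
  | .atom x => Set.finite_singleton x
  | .top => Set.finite_empty
  | .neg φ => φ.finite_gens
  | .and φ ψ => φ.finite_gens.union ψ.finite_gens

theorem PForm.toFm_congr {X : Type*} {f f' : X → Fm P A Sig ar} :
    ∀ {e : PForm X}, (∀ x ∈ e.gens, f x = f' x) → e.toFm f = e.toFm f'
  | .atom x, h => h x rfl
  | .top, _ => rfl
  | .neg φ, h => congrArg Fm.neg (PForm.toFm_congr (e := φ) h)
  | .and φ ψ, h => congrArg₂ Fm.and (PForm.toFm_congr (e := φ) fun x hx => h x (.inl hx))
      (PForm.toFm_congr (e := ψ) fun x hx => h x (.inr hx))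

theorem PForm.eval_map {X Y : Type*} (f : X → Y) (w : Y → Prop) (e : PForm X) :
    (e.map f).eval w ↔ e.eval fun x => w (f x) := by
  induction e with
  | atom x => rfl
  | top => rfl
  | neg φ ih => exact not_congr ih
  | and φ ψ ih ih' => exact and_congr ih ih'

theorem PForm.eval_congr {X : Type*} {w w' : X → Prop} (h : ∀ x, w x ↔ w' x) (e : PForm X) :
    e.eval w ↔ e.eval w' := by
  rw [show w = w' from funext fun x => propext (h x)]

theorem PForm.eval_bigAnd {X : Type*} {w : X → Prop} :
    ∀ {l : List (PForm X)}, (∀ φ ∈ l, φ.eval w) → (PForm.bigAnd l).eval w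
  | [], _ => trivial
  | φ :: l, h => ⟨h φ (by simp), PForm.eval_bigAnd fun ψ hψ => h ψ (by simp [hψ])⟩

end Substitution

theorem PosGenerated.mono {G : Type*} {a : Set (Set G)} (h : PosGenerated a) {S S' : Set G}
    (hS : S ⊆ S') : S ∈ a → S' ∈ a := by
  induction h with
  | gen g => exact fun hg => hS hg
  | and _ _ ih ih' => exact fun h => ⟨ih h.1, ih' h.2⟩
  | or _ _ ih ih' => exact fun h => h.imp ih ih'

section Semantics

variable {T : Type u → Type u} [Monad T] {lam : PredLift T}

theorem PointwiseOp.Positive.eval_mono {n : ℕ} {o : PointwiseOp lam n} (ho : o.Positive)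
    {w w' : Gen.{u} n → Prop} (h : ∀ g, w g → w' g) : o.expr.eval w → o.expr.eval w' := by
  have key : ∀ w : Gen.{u} n → Prop, o.expr.eval w ↔ {g | w g} ∈ o.χ.yon := fun w => by
    rw [← o.expr_denotes]; rfl
  rw [key, key]
  exact PosGenerated.mono ho h

/-- The subset of `Y` obtained from `U` by the Boolean combination `V ⊆ 2`. -/
def combSet {Y : Type u} (V : Set Two.{u}) (U : Set Y) : Set Y :=
  {y | ∃ b ∈ V, (b.down = true ↔ y ∈ U)}

theorem PointwiseOp.σ_mem_iff {n : ℕ} (o : PointwiseOp lam n) {X : Type u} (t : Fin n → T X)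
    (U : Set X) : o.σ.app t ∈ lam.app U ↔
      o.expr.eval fun g => t g.1 ∈ lam.app (combSet g.2 U) := by
  classical
  let f : X → Two.{u} := fun x => ⟨decide (x ∈ U)⟩
  have hf : ∀ V : Set Two.{u}, f ⁻¹' V = combSet V U := fun V => by
    ext x
    refine ⟨fun h => ⟨f x, h, by simp [f]⟩, ?_⟩
    rintro ⟨⟨b⟩, hb, hx⟩
    have : f x = ⟨b⟩ := by
      simp only [f, ULift.up.injEq]
      cases b <;> simp_all
    exact (congrArg (· ∈ V) this).mpr hb
  have hU : f ⁻¹' {ULift.up true} = U := by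
    ext x; simp [f]
  have h1 : o.σ.app t ∈ lam.app U ↔ U ∈ o.χ.app fun i => lam.transpose (t i) := by
    rw [← o.comm]; rfl
  have h2 : U ∈ (o.χ.app fun i => lam.transpose (t i)) ↔
      ({ULift.up true} : Set Two.{u}) ∈ f <$> (o.χ.app fun i => lam.transpose (t i)) := by
    conv_lhs => rw [← hU]
    rfl
  have h3 : (o.expr.eval fun g => t g.1 ∈ lam.app (combSet g.2 U)) ↔
      {g : Gen.{u} n | t g.1 ∈ lam.app (combSet g.2 U)} ∈ o.χ.yon := by
    rw [← o.expr_denotes]; rfl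
  rw [h1, h2, h3, ← o.χ.naturality]
  have h4 : (fun i => f <$> lam.transpose (t i)) = fun i =>
      (({V | (i, V) ∈ {g : Gen.{u} n | t g.1 ∈ lam.app (combSet g.2 U)}} :
        Set (Set Two.{u})) : Nbhd Two.{u}) := by
    funext i
    refine Set.ext fun V => ?_
    change t i ∈ lam.app (f ⁻¹' V) ↔ t i ∈ lam.app (combSet V U)
    rw [hf]
  rw [h4]; rfl

variable (hmor : IsMonadMorphism (T := T) (T' := Nbhd) lam.transpose)

include hmor

theorem PredLift.pure_mem_iff {X : Type u} (x : X) (U : Set X) :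
    (pure x : T X) ∈ lam.app U ↔ x ∈ U := by
  change U ∈ lam.transpose (pure x : T X) ↔ _
  rw [hmor.map_pure]; rfl

theorem PredLift.bind_mem_iff {X Y : Type u} (t : T X) (f : X → T Y) (U : Set Y) :
    t >>= f ∈ lam.app U ↔ t ∈ lam.app {x | f x ∈ lam.app U} := by
  change U ∈ lam.transpose (t >>= f) ↔ _
  rw [hmor.map_bind]; rfl

variable [∀ X : Type u, CompleteSemilatticeSup (T X)] (hdia : lam.DiamondLike)

include hdia

theorem testAct_mem_iff {X : Type u} (W U : Set X) (x : X) :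
    (testAct W x : T X) ∈ lam.app U ↔ x ∈ W ∧ x ∈ U := by
  unfold testAct
  split_ifs with h
  · simp [PredLift.pure_mem_iff hmor, h]
  · simp [hdia X U ∅, h]

omit hmor in
theorem kstar_mem_iff {X : Type u} (f : X → T X) (U : Set X) (x : X) :
    kstar f x ∈ lam.app U ↔ ∃ n, kpow f n x ∈ lam.app U := by
  unfold kstar kJoin
  rw [hdia]
  constructor
  · rintro ⟨_, ⟨_, ⟨n, rfl⟩, rfl⟩, h⟩
    exact ⟨n, h⟩
  · rintro ⟨n, h⟩
    exact ⟨_, ⟨_, ⟨n, rfl⟩, rfl⟩, h⟩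

theorem kstar_mem_of_step (hT : LeftQuantalic T) {X : Type u} (f : X → T X) (U : Set X) (x : X)
    (h : f x ∈ lam.app {y | kstar f y ∈ lam.app U}) : kstar f x ∈ lam.app U := by
  rw [← PredLift.bind_mem_iff hmor] at h
  change kcomp f (kJoin (Set.range (kpow f))) x ∈ _ at h
  rw [hT] at h
  obtain ⟨_, ⟨_, ⟨_, ⟨n, rfl⟩, rfl⟩, rfl⟩, h⟩ := (hdia _ _ _).1 h
  exact (kstar_mem_iff hdia f U x).2 ⟨n + 1, h⟩

end Semantics

/-! ### Maximal consistent theories -/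

section Theories

variable {P A Sig : Type v} {ar : Sig → ℕ} {T : Type u → Type u} [Monad T] {lam : PredLift T}

/-- Maximal consistent theories of the dynamic logic. -/
structure MaxTheory (A : Type v) (L : BaseLogic P) (θ : ∀ s : Sig, PointwiseOp lam (ar s)) where
  carrier : Set (Fm P A Sig ar)
  derivable : ∀ {φ}, DynDerivable L θ φ → φ ∈ carrier
  mp : ∀ {φ ψ}, φ.imp ψ ∈ carrier → φ ∈ carrier → ψ ∈ carrier
  neg_mem_iff : ∀ {φ}, φ.neg ∈ carrier ↔ φ ∉ carrier

variable {L : BaseLogic P} {θ : ∀ s : Sig, PointwiseOp lam (ar s)}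

instance : Membership (Fm P A Sig ar) (MaxTheory A L θ) := ⟨fun Δ φ => φ ∈ Δ.carrier⟩

/-- Lindenbaum's lemma. -/
theorem MaxTheory.exists_not_mem {φ : Fm P A Sig ar} (h : ¬ DynDerivable L θ φ) :
    ∃ Δ : MaxTheory A L θ, φ ∉ Δ := by
  obtain ⟨Γ, hΓ, hmax⟩ := zorn_subset_nonempty
    {Γ : Set (Fm P A Sig ar) | {ψ | DynDerivable L θ ψ} ⊆ Γ ∧
      (∀ ψ χ, ψ.imp χ ∈ Γ → ψ ∈ Γ → χ ∈ Γ) ∧ φ ∉ Γ} (by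
      rintro c hc hch ⟨Γ₀, hΓ₀⟩
      refine ⟨⋃₀ c, ⟨(hc hΓ₀).1.trans (Set.subset_sUnion_of_mem hΓ₀), ?_, ?_⟩,
        fun s hs => Set.subset_sUnion_of_mem hs⟩
      · rintro ψ χ ⟨Γ₁, h₁, hi⟩ ⟨Γ₂, h₂, hψ⟩
        rcases hch.total h₁ h₂ with hle | hle
        · exact ⟨Γ₂, h₂, (hc h₂).2.1 _ _ (hle hi) hψ⟩
        · exact ⟨Γ₁, h₁, (hc h₁).2.1 _ _ hi (hle hψ)⟩
      · rintro ⟨Γ₁, h₁, hφ⟩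
        exact (hc h₁).2.2 hφ)
    {ψ | DynDerivable L θ ψ} ⟨subset_rfl, fun _ _ h h' => Derivable.mp h h', h⟩
  obtain ⟨-, hmp, hφ⟩ := hmax.prop
  have taut : ∀ {ψ : Fm P A Sig ar}, ψ.Tautology → ψ ∈ Γ := fun h => hΓ (Derivable.taut h)
  have key : ∀ ψ, ψ ∉ Γ → ψ.imp φ ∈ Γ := by
    intro ψ hψ
    by_contra hn
    have hsub : Γ ⊆ {χ | ψ.imp χ ∈ Γ} := fun χ hχ =>
      hmp _ _ (taut fun w h0 h1 h2 => by simp only [Fm.imp, h1, h2]; tauto) hχ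
    refine hψ (hmax.le_of_ge ⟨hΓ.trans hsub, fun χ ξ h h' => ?_, hn⟩ hsub ?_)
    · refine hmp _ _ (hmp _ _ (taut fun w h0 h1 h2 => ?_) h) h'
      simp only [Fm.imp, h1, h2]; tauto
    · exact taut fun w h0 h1 h2 => by simp only [Fm.imp, h1, h2]; tauto
  refine ⟨⟨Γ, fun h => hΓ h, fun h h' => hmp _ _ h h', fun {ψ} => ⟨fun h h' => hφ ?_, fun h => ?_⟩⟩,
    hφ⟩
  · refine hmp _ _ (hmp _ _ (taut fun w h0 h1 h2 => ?_) h) h'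
    simp only [Fm.imp, h1, h2]; tauto
  · by_contra hn
    refine hφ (hmp _ _ (hmp _ _ (taut fun w h0 h1 h2 => ?_) (key _ h)) (key _ hn))
    simp only [Fm.imp, h1, h2]; tauto

theorem DynDerivable.of_forall_mem {φ : Fm P A Sig ar} (h : ∀ Δ : MaxTheory A L θ, φ ∈ Δ) :
    DynDerivable L θ φ := by
  by_contra hn
  obtain ⟨Δ, hΔ⟩ := MaxTheory.exists_not_mem hn
  exact hΔ (h Δ)

namespace MaxTheory

variable (Δ : MaxTheory A L θ) {φ ψ : Fm P A Sig ar}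

theorem mem_neg : φ.neg ∈ Δ ↔ φ ∉ Δ := Δ.neg_mem_iff

theorem mem_of_tautology (h : φ.Tautology) : φ ∈ Δ := Δ.derivable (Derivable.taut h)

theorem mem_and : φ.and ψ ∈ Δ ↔ φ ∈ Δ ∧ ψ ∈ Δ := by
  refine ⟨fun h => ⟨Δ.mp (Δ.mem_of_tautology fun w h0 h1 h2 => ?_) h,
    Δ.mp (Δ.mem_of_tautology fun w h0 h1 h2 => ?_) h⟩, fun h =>
    Δ.mp (Δ.mp (Δ.mem_of_tautology fun w h0 h1 h2 => ?_) h.1) h.2⟩ <;>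
  · simp only [Fm.imp, h1, h2]; tauto

theorem not_mem_bot : (Fm.bot : Fm P A Sig ar) ∉ Δ := by
  rw [← mem_neg]
  exact Δ.mem_of_tautology fun w h0 h1 h2 => by simpa only [h1] using h0

theorem mem_top : (Fm.top : Fm P A Sig ar) ∈ Δ := Δ.mem_neg.2 Δ.not_mem_bot

theorem mem_or : φ.or ψ ∈ Δ ↔ φ ∈ Δ ∨ ψ ∈ Δ := by
  simp only [Fm.or, mem_neg, mem_and]; tauto

theorem mem_imp : φ.imp ψ ∈ Δ ↔ (φ ∈ Δ → ψ ∈ Δ) := by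
  simp only [Fm.imp, mem_neg, mem_and]; tauto

theorem mem_iff : φ.iff ψ ∈ Δ ↔ (φ ∈ Δ ↔ ψ ∈ Δ) := by
  simp only [Fm.iff, mem_imp, mem_and]; tauto

theorem mem_toFm {X : Type*} (f : X → Fm P A Sig ar) (e : PForm X) :
    e.toFm f ∈ Δ ↔ e.eval fun x => f x ∈ Δ := by
  induction e with
  | atom x => rfl
  | top => exact iff_of_true Δ.mem_top trivial
  | neg φ ih => exact Δ.mem_neg.trans (not_congr ih)
  | and φ ψ ih ih' => exact Δ.mem_and.trans (and_congr ih ih')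

theorem mem_boolComb (V : Set Two.{u}) :
    boolComb V φ ∈ Δ ↔ ∃ b ∈ V, (b.down = true ↔ φ ∈ Δ) := by
  unfold boolComb
  split_ifs with h h' h' <;>
    simp only [mem_top, mem_neg, not_mem_bot, ULift.exists, Bool.exists_bool, h, h'] <;> simp
  tauto

theorem mem_mod_congr (α : Act P A Sig ar) (h : ∀ Δ : MaxTheory A L θ, φ ∈ Δ ↔ ψ ∈ Δ) :
    Fm.mod α φ ∈ Δ ↔ Fm.mod α ψ ∈ Δ := by
  have h1 : DynDerivable L θ (φ.iff ψ) := .of_forall_mem fun Δ => Δ.mem_iff.2 (h Δ)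
  have h2 : DynDerivable L θ ((Fm.mod α φ).iff (.mod α ψ)) := by
    have := Derivable.rule (Ax := dynAx L θ) (Fr := dynFr) (Ru := dynRules L)
      (φ := φ.iff ψ) (ψ := (Fm.mod α φ).iff (.mod α ψ)) .atom
      (.inl (.inr ⟨α, φ, ψ, rfl⟩)) (by rwa [Fm.subst_atom])
    rwa [Fm.subst_atom] at this
  exact Δ.mem_iff.1 (Δ.derivable h2)

theorem mem_of_mem_star (α : Act P A Sig ar)
    (h : ∀ Δ : MaxTheory A L θ, Fm.mod α ψ ∈ Δ ∨ φ ∈ Δ → ψ ∈ Δ)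
    (hφ : Fm.mod (.star α) φ ∈ Δ) : ψ ∈ Δ := by
  have h1 : DynDerivable L θ (((Fm.mod α ψ).or φ).imp ψ) :=
    .of_forall_mem fun Δ => Δ.mem_imp.2 fun h' => h Δ (Δ.mem_or.1 h')
  have h2 : DynDerivable L θ ((Fm.mod (.star α) φ).imp ψ) := by
    have := Derivable.rule (Ax := dynAx L θ) (Fr := dynFr) (Ru := dynRules L)
      (φ := ((Fm.mod α ψ).or φ).imp ψ) (ψ := (Fm.mod (.star α) φ).imp ψ) .atom
      (.inr ⟨α, φ, ψ, rfl⟩) (by rwa [Fm.subst_atom])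
    rwa [Fm.subst_atom] at this
  exact Δ.mem_imp.1 (Δ.derivable h2) hφ

section Axioms

variable [Infinite P]

theorem mem_comp (α β : Act P A Sig ar) :
    Fm.mod (.comp α β) φ ∈ Δ ↔ Fm.mod α (.mod β φ) ∈ Δ := by
  obtain ⟨p⟩ : Nonempty P := inferInstance
  obtain ⟨r, s, hs, -, hα⟩ := exists_renaming (A := A) (Sig := Sig) (ar := ar)
    (Set.finite_singleton p) fun _ => φ
  have h : DynDerivable L θ _ := Derivable.subst s
    (Derivable.fr (.inl (.inl ⟨α.subst r, β.subst r, p, rfl⟩)))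
  simp only [Fm.iff, Fm.imp, Fm.subst, Act.subst, hα, hs p rfl] at h
  exact Δ.mem_iff.1 (Δ.derivable h)

theorem mem_star (α : Act P A Sig ar) :
    Fm.mod (.star α) φ ∈ Δ ↔ φ ∈ Δ ∨ Fm.mod α (.mod (.star α) φ) ∈ Δ := by
  obtain ⟨p⟩ : Nonempty P := inferInstance
  obtain ⟨r, s, hs, -, hα⟩ := exists_renaming (A := A) (Sig := Sig) (ar := ar)
    (Set.finite_singleton p) fun _ => φ
  have h : DynDerivable L θ _ := Derivable.subst s
    (Derivable.fr (.inl (.inr ⟨α.subst r, p, rfl⟩)))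
  simp only [Fm.iff, Fm.imp, Fm.or, Fm.subst, Act.subst, hα, hs p rfl] at h
  exact (Δ.mem_iff.1 (Δ.derivable h)).trans Δ.mem_or

theorem mem_test : Fm.mod (.test ψ) φ ∈ Δ ↔ ψ ∈ Δ ∧ φ ∈ Δ := by
  obtain ⟨p⟩ : Nonempty P := inferInstance
  obtain ⟨r, s, hs, hψ, -⟩ := exists_renaming (A := A) (Sig := Sig) (ar := ar)
    (Set.finite_singleton p) fun _ => φ
  have h : DynDerivable L θ _ := Derivable.subst s
    (Derivable.fr (.inr ⟨ψ.subst r, p, rfl⟩))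
  simp only [Fm.iff, Fm.imp, Fm.subst, Act.subst, hψ, hs p rfl] at h
  exact (Δ.mem_iff.1 (Δ.derivable h)).trans Δ.mem_and

theorem mem_op (f : Sig) (α : Fin (ar f) → Act P A Sig ar) :
    Fm.mod (.op f α) φ ∈ Δ ↔
      (θ f).expr.eval fun g => Fm.mod (α g.1) (boolComb g.2 φ) ∈ Δ := by
  obtain ⟨p⟩ : Nonempty P := inferInstance
  obtain ⟨r, s, hs, -, hα⟩ := exists_renaming (A := A) (Sig := Sig) (ar := ar)
    (Set.finite_singleton p) fun _ => φ
  have h : DynDerivable L θ _ := Derivable.subst s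
    (Derivable.ax (.inr ⟨f, fun i => (α i).subst r, p, rfl⟩))
  simp only [Fm.iff, Fm.imp, pwFormula, Fm.subst, Act.subst, PForm.subst_toFm, boolComb_subst,
    hα, hs p rfl] at h
  exact (Δ.mem_iff.1 (Δ.derivable h)).trans (Δ.mem_toFm _ _)

theorem eval_ax (α : Act P A Sig ar) {ψ : PForm (PForm P)} (hψ : ψ ∈ L.ax)
    (s₀ : P → Fm P A Sig ar) : ψ.eval fun π => Fm.mod α (π.toFm s₀) ∈ Δ := by
  obtain ⟨r, s, hs, -, hα⟩ := exists_renaming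
    (ψ.finite_gens.biUnion fun π _ => π.finite_gens) s₀
  have h : DynDerivable L θ _ := Derivable.subst s
    (Derivable.ax (.inl ⟨α.subst r, ψ, hψ, rfl⟩))
  simp only [labelAx, PForm.subst_toFm, Fm.subst, hα] at h
  rw [PForm.toFm_congr (f' := fun π => Fm.mod α (π.toFm s₀)) fun π hπ => by
    rw [PForm.toFm_congr fun p hp => hs p (Set.mem_biUnion hπ hp)]] at h
  exact (Δ.mem_toFm _ _).1 (Δ.derivable h)

end Axioms

end MaxTheory

/-! ### Finite closed sets of formulas -/

/-- `Requires φ ψ`: a set of formulas that is closed and contains `φ` has to contain `ψ`. -/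
inductive Requires : Fm P A Sig ar → Fm P A Sig ar → Prop
  | neg (φ) : Requires (.neg φ) φ
  | and_left (φ ψ) : Requires (.and φ ψ) φ
  | and_right (φ ψ) : Requires (.and φ ψ) ψ
  | mod (α φ) : Requires (.mod α φ) φ
  | comp (α β φ) : Requires (.mod (.comp α β) φ) (.mod α (.mod β φ))
  | op (f : Sig) (α : Fin (ar f) → Act P A Sig ar) (φ) (i : Fin (ar f)) (V : Set Two.{0}) :
      Requires (.mod (.op f α) φ) (.mod (α i) (boolComb V φ))
  | star (α φ) : Requires (.mod (.star α) φ) (.mod α (.mod (.star α) φ))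
  | test (ψ φ) : Requires (.mod (.test ψ) φ) ψ

theorem exists_boolComb_eq (V : Set Two.{u}) (φ : Fm P A Sig ar) :
    ∃ V' : Set Two.{0}, boolComb V φ = boolComb V' φ := by
  refine ⟨{b | ULift.up b.down ∈ V}, ?_⟩
  unfold boolComb
  rfl

mutual

theorem Fm.exists_finite_closed : ∀ φ : Fm P A Sig ar,
    ∃ S : Set (Fm P A Sig ar), S.Finite ∧ φ ∈ S ∧ ∀ ψ ∈ S, ∀ ξ, Requires ψ ξ → ξ ∈ S
  | .atom p => ⟨{.atom p}, Set.finite_singleton _, rfl, by rintro _ rfl _ ⟨⟩⟩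
  | .bot => ⟨{.bot}, Set.finite_singleton _, rfl, by rintro _ rfl _ ⟨⟩⟩
  | .neg φ => by
      obtain ⟨S, hS, hφ, hc⟩ := Fm.exists_finite_closed φ
      refine ⟨insert φ.neg S, hS.insert _, .inl rfl, ?_⟩
      rintro ψ (rfl | hψ) ξ h
      · cases h; exact .inr hφ
      · exact .inr (hc ψ hψ ξ h)
  | .and φ φ' => by
      obtain ⟨S, hS, hφ, hc⟩ := Fm.exists_finite_closed φ
      obtain ⟨S', hS', hφ', hc'⟩ := Fm.exists_finite_closed φ'
      refine ⟨insert (φ.and φ') (S ∪ S'), (hS.union hS').insert _, .inl rfl, ?_⟩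
      rintro ψ (rfl | hψ | hψ) ξ h
      · cases h
        exacts [.inr (.inl hφ), .inr (.inr hφ')]
      · exact .inr (.inl (hc ψ hψ ξ h))
      · exact .inr (.inr (hc' ψ hψ ξ h))
  | .mod α φ => by
      obtain ⟨S, hS, hφ, hc⟩ := Fm.exists_finite_closed φ
      obtain ⟨S', hS', hφ', hc'⟩ := Act.exists_finite_closed α φ
      refine ⟨S ∪ S', hS.union hS', .inr hφ', ?_⟩
      rintro ψ (hψ | hψ) ξ h
      · exact .inl (hc ψ hψ ξ h)
      · rcases hc' ψ hψ ξ h with h | rfl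
        exacts [.inr h, .inl hφ]

/-- There is a finite set that contains `⟨α⟩φ` and is closed up to `φ`. -/
theorem Act.exists_finite_closed : ∀ (α : Act P A Sig ar) (φ : Fm P A Sig ar),
    ∃ S : Set (Fm P A Sig ar), S.Finite ∧ .mod α φ ∈ S ∧
      ∀ ψ ∈ S, ∀ ξ, Requires ψ ξ → ξ ∈ S ∨ ξ = φ
  | .atom a, φ => ⟨{.mod (.atom a) φ}, Set.finite_singleton _, rfl, by
      rintro _ rfl _ ⟨⟩; exact .inr rfl⟩
  | .comp α β, φ => by
      obtain ⟨S, hS, hφ, hc⟩ := Act.exists_finite_closed β φ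
      obtain ⟨S', hS', hφ', hc'⟩ := Act.exists_finite_closed α (.mod β φ)
      refine ⟨insert (.mod (.comp α β) φ) (S ∪ S'), (hS.union hS').insert _, .inl rfl, ?_⟩
      rintro ψ (rfl | hψ | hψ) ξ h
      · cases h
        exacts [.inr rfl, .inl (.inr (.inr hφ'))]
      · exact (hc ψ hψ ξ h).imp_left fun h => .inr (.inl h)
      · rcases hc' ψ hψ ξ h with h | rfl
        exacts [.inl (.inr (.inr h)), .inl (.inr (.inl hφ))]
  | .op f α, φ => by
      choose S hS hφ hc using fun i (V : Set Two.{0}) =>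
        Act.exists_finite_closed (α i) (boolComb V φ)
      refine ⟨insert (.mod (.op f α) φ) ({.neg φ, .top, .bot} ∪ ⋃ i, ⋃ V, S i V),
        (Set.Finite.union (by simp) (Set.finite_iUnion fun i => Set.finite_iUnion (hS i))).insert _,
        .inl rfl, ?_⟩
      rintro ψ (rfl | (rfl | rfl | rfl) | hψ) ξ h
      · cases h with
        | mod => exact .inr rfl
        | op _ _ _ i V => exact .inl (.inr (.inr (Set.mem_iUnion₂.2 ⟨i, V, hφ i V⟩)))
      · cases h; exact .inr rfl
      · cases h; exact .inl (.inr (.inl (.inr (.inr rfl))))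
      · cases h
      · obtain ⟨i, V, hψ⟩ := Set.mem_iUnion₂.1 hψ
        rcases hc i V ψ hψ ξ h with h | rfl
        · exact .inl (.inr (.inr (Set.mem_iUnion₂.2 ⟨i, V, h⟩)))
        · unfold boolComb
          split_ifs
          exacts [.inl (.inr (.inl (.inr (.inl rfl)))), .inr rfl, .inl (.inr (.inl (.inl rfl))),
            .inl (.inr (.inl (.inr (.inr rfl))))]
  | .star α, φ => by
      obtain ⟨S, hS, hφ, hc⟩ := Act.exists_finite_closed α (.mod (.star α) φ)
      refine ⟨insert (.mod (.star α) φ) S, hS.insert _, .inl rfl, ?_⟩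
      rintro ψ (rfl | hψ) ξ h
      · cases h
        exacts [.inr rfl, .inl (.inr hφ)]
      · rcases hc ψ hψ ξ h with h | rfl
        exacts [.inl (.inr h), .inl (.inl rfl)]
  | .test χ, φ => by
      obtain ⟨S, hS, hφ, hc⟩ := Fm.exists_finite_closed χ
      refine ⟨insert (.mod (.test χ) φ) S, hS.insert _, .inl rfl, ?_⟩
      rintro ψ (rfl | hψ) ξ h
      · cases h
        exacts [.inr rfl, .inl (.inr hφ)]
      · exact .inl (.inr (hc ψ hψ ξ h))

end

/-! ### Filtrations -/

/-- A finite quotient of the space of maximal theories on which all formulas from `S` are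
well-defined and all subsets are definable by formulas. -/
structure Filtration (A : Type v) (L : BaseLogic P) (θ : ∀ s : Sig, PointwiseOp lam (ar s))
    (S : Set (Fm P A Sig ar)) (X : Type u) where
  proj : MaxTheory A L θ → X
  surj : Function.Surjective proj
  hat : Set X → Fm P A Sig ar
  mem_hat : ∀ (U : Set X) (Δ : MaxTheory A L θ), hat U ∈ Δ ↔ proj Δ ∈ U
  ext : Fm P A Sig ar → Set X
  mem_ext : ∀ φ ∈ S, ∀ Δ : MaxTheory A L θ, proj Δ ∈ ext φ ↔ φ ∈ Δ

theorem MaxTheory.exists_mem_iff_forall {ι : Type*} {s : Set ι} (hs : s.Finite)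
    {C : ι → MaxTheory A L θ → Prop}
    (h : ∀ i ∈ s, ∃ ψ : Fm P A Sig ar, ∀ Δ : MaxTheory A L θ, ψ ∈ Δ ↔ C i Δ) :
    ∃ ψ : Fm P A Sig ar, ∀ Δ : MaxTheory A L θ, ψ ∈ Δ ↔ ∀ i ∈ s, C i Δ := by
  induction s, hs using Set.Finite.induction_on with
  | empty => exact ⟨.top, fun Δ => by simp [Δ.mem_top]⟩
  | @insert i s _ _ ih =>
    obtain ⟨ψ, hψ⟩ := h i (.inl rfl)
    obtain ⟨ψ', hψ'⟩ := ih fun j hj => h j (.inr hj)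
    exact ⟨ψ.and ψ', fun Δ => by simp [Δ.mem_and, hψ, hψ']⟩

theorem exists_filtration (A : Type v) (L : BaseLogic P)
    (θ : ∀ s : Sig, PointwiseOp lam (ar s)) {S : Set (Fm P A Sig ar)} (hS : S.Finite) :
    ∃ X : Type u, Finite X ∧ Nonempty (Filtration A L θ S X) := by
  have : Finite S := hS
  let r : MaxTheory A L θ → Set S := fun Δ => {ψ | (ψ : Fm P A Sig ar) ∈ Δ}
  obtain ⟨n, ⟨e⟩⟩ := Finite.exists_equiv_fin (Set.range r)
  let g : MaxTheory A L θ → ULift.{u} (Fin n) := fun Δ => ⟨e ⟨r Δ, Δ, rfl⟩⟩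
  have hg : ∀ Δ Δ', g Δ = g Δ' ↔ r Δ = r Δ' := fun Δ Δ' => by
    simp only [g, ULift.up.injEq, e.injective.eq_iff]
    exact Subtype.mk_eq_mk
  have hsurj : Function.Surjective g := by
    rintro ⟨k⟩
    obtain ⟨⟨_, Δ, rfl⟩, hΔ⟩ := e.surjective k
    exact ⟨Δ, congrArg ULift.up hΔ⟩
  have hne : ∀ x, ∃ ψ : Fm P A Sig ar, ∀ Δ : MaxTheory A L θ, ψ ∈ Δ ↔ g Δ ≠ x := by
    intro x
    obtain ⟨Δ₀, rfl⟩ := hsurj x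
    obtain ⟨ψ, hψ⟩ := MaxTheory.exists_mem_iff_forall (L := L) (θ := θ) hS
      (C := fun ψ Δ => ψ ∈ Δ ↔ ψ ∈ Δ₀) fun ψ _ => by
        by_cases h : ψ ∈ Δ₀
        · exact ⟨ψ, fun Δ => by simp [h]⟩
        · exact ⟨ψ.neg, fun Δ => by simp [h, Δ.mem_neg]⟩
    refine ⟨ψ.neg, fun Δ => ?_⟩
    rw [Δ.mem_neg, hψ, Ne, hg, Set.ext_iff]
    simp [r]
  have hhat : ∀ U : Set (ULift.{u} (Fin n)), ∃ ψ : Fm P A Sig ar,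
      ∀ Δ : MaxTheory A L θ, ψ ∈ Δ ↔ g Δ ∈ U := by
    intro U
    obtain ⟨ψ, hψ⟩ := MaxTheory.exists_mem_iff_forall (Set.toFinite Uᶜ) fun x _ => hne x
    refine ⟨ψ, fun Δ => (hψ Δ).trans ⟨fun h => ?_, fun h x hx hΔ => hx (hΔ ▸ h)⟩⟩
    by_contra hU
    exact h _ hU rfl
  choose hat hat_spec using hhat
  refine ⟨ULift.{u} (Fin n), inferInstance, ⟨⟨g, hsurj, hat, hat_spec,
    fun φ => {x | ∃ Δ, g Δ = x ∧ φ ∈ Δ}, fun φ hφ Δ => ⟨?_, fun h => ⟨Δ, rfl, h⟩⟩⟩⟩⟩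
  rintro ⟨Δ', h, h'⟩
  have := Set.ext_iff.1 ((hg _ _).1 h) ⟨φ, hφ⟩
  exact this.1 h'

namespace Filtration

variable {S : Set (Fm P A Sig ar)} {X : Type u} (F : Filtration A L θ S X)

/-- Every maximal theory is realized, modulo the filtration, by an element of `T X`. -/
theorem exists_realizer [Infinite P] [Finite X] (hL : L.OneStepComplete lam)
    (Δ : MaxTheory A L θ) (α : Act P A Sig ar) :
    ∃ t : T X, ∀ U, t ∈ lam.app U ↔ Fm.mod α (F.hat U) ∈ Δ := by
  let w : Set X → Prop := fun U => Fm.mod α (F.hat U) ∈ Δ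
  have hw : ∀ ψ ∈ L.ax, ∀ τ : P → Set X, (ψ.map (PForm.setEval τ)).eval w := by
    intro ψ hψ τ
    rw [PForm.eval_map]
    refine (PForm.eval_congr (fun π => Δ.mem_mod_congr α fun Δ' => ?_) ψ).1
      (Δ.eval_ax α hψ fun p => F.hat (τ p))
    rw [Δ'.mem_toFm, F.mem_hat]
    exact PForm.eval_congr (fun p => F.mem_hat (τ p) Δ') π
  obtain ⟨t, ht⟩ := hL X {φ | φ.eval w} (by
    rintro ⟨l, hl, hd⟩
    exact hd w hw ⟨PForm.eval_bigAnd hl, fun h => h trivial⟩)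
  refine ⟨t, fun U => ⟨fun h => ?_, fun h => ht (.atom U) h⟩⟩
  by_contra hn
  exact ht (.neg (.atom U)) hn h

end Filtration

theorem MaxTheory.mem_mod_mono [Infinite P] (hL : L.OneStepComplete lam)
    (hmono : lam.Monotonic) (Δ : MaxTheory A L θ) (α : Act P A Sig ar) {φ ψ : Fm P A Sig ar}
    (h : ∀ Δ : MaxTheory A L θ, φ ∈ Δ → ψ ∈ Δ) (hφ : Fm.mod α φ ∈ Δ) : Fm.mod α ψ ∈ Δ := by
  obtain ⟨X, _, ⟨F⟩⟩ := exists_filtration A L θ (Set.toFinite {φ, ψ})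
  obtain ⟨t, ht⟩ := F.exists_realizer hL Δ α
  have key : ∀ χ ∈ ({φ, ψ} : Set (Fm P A Sig ar)), t ∈ lam.app (F.ext χ) ↔ Fm.mod α χ ∈ Δ :=
    fun χ hχ => (ht _).trans (Δ.mem_mod_congr α fun Δ' => by rw [F.mem_hat, F.mem_ext χ hχ])
  refine (key ψ (.inr rfl)).1 (hmono _ _ _ (fun y hy => ?_) ((key φ (.inl rfl)).2 hφ))
  obtain ⟨Δ', rfl⟩ := F.surj y
  rw [F.mem_ext _ (.inl rfl)] at hy
  exact (F.mem_ext ψ (.inr rfl) _).2 (h Δ' hy)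

namespace Filtration

variable {S : Set (Fm P A Sig ar)} {X : Type u} (F : Filtration A L θ S X)

variable [∀ X : Type u, CompleteSemilatticeSup (T X)]

/-- The canonical model on a filtration. -/
def model : DynModel T P A X where
  γ₀ a x := sSup {t | ∃ Δ, F.proj Δ = x ∧ ∀ U, t ∈ lam.app U ↔ Fm.mod (.atom a) (F.hat U) ∈ Δ}
  val p := F.ext (.atom p)

variable [Infinite P] [Finite X]
  (hT : LeftQuantalic T) (hmono : lam.Monotonic) (hdia : lam.DiamondLike)
  (hmor : IsMonadMorphism (T := T) (T' := Nbhd) lam.transpose)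
  (hpos : ∀ s : Sig, (θ s).Positive) (hL : L.OneStepComplete lam)
  (hS : ∀ ψ ∈ S, ∀ ξ, Requires ψ ξ → ξ ∈ S)

include hT hmono hdia hmor hpos hL hS

mutual

/-- The truth lemma. -/
theorem truth_model : ∀ φ ∈ S, F.model.truth θ φ = F.ext φ
  | .atom p, _ => by rw [DynModel.truth]; rfl
  | .bot, h => by
      ext x
      obtain ⟨Δ, rfl⟩ := F.surj x
      rw [DynModel.truth, F.mem_ext _ h]
      exact iff_of_false id Δ.not_mem_bot
  | .neg φ, h => by
      have hφ := hS _ h _ (.neg φ)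
      ext x
      obtain ⟨Δ, rfl⟩ := F.surj x
      rw [DynModel.truth, truth_model φ hφ, F.mem_ext _ h, Δ.mem_neg, Set.mem_compl_iff,
        F.mem_ext _ hφ]
  | .and φ ψ, h => by
      have hφ := hS _ h _ (.and_left φ ψ)
      have hψ := hS _ h _ (.and_right φ ψ)
      ext x
      obtain ⟨Δ, rfl⟩ := F.surj x
      rw [DynModel.truth, truth_model φ hφ, truth_model ψ hψ, F.mem_ext _ h, Δ.mem_and,
        Set.mem_inter_iff, F.mem_ext _ hφ, F.mem_ext _ hψ]
  | .mod α φ, h => by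
      have hφ := hS _ h _ (.mod α φ)
      ext x
      obtain ⟨Δ, rfl⟩ := F.surj x
      rw [DynModel.truth, truth_model φ hφ, Set.mem_ofPred_eq]
      refine ⟨act_model_sound α φ h (F.proj Δ), fun h' => ?_⟩
      refine act_model_complete α φ h Δ _ ((Δ.mem_mod_congr α fun Δ' => ?_).1
        ((F.mem_ext _ h _).1 h'))
      rw [F.mem_hat, F.mem_ext _ hφ]

/-- Diamonds over definable sets in a maximal theory are true in the canonical model. -/
theorem act_model_complete : ∀ (α : Act P A Sig ar) (φ), .mod α φ ∈ S →
    ∀ (Δ : MaxTheory A L θ) (U : Set X), .mod α (F.hat U) ∈ Δ →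
      F.model.act θ α (F.proj Δ) ∈ lam.app U
  | .atom a, _, _, Δ, U, h => by
      rw [DynModel.act]
      obtain ⟨t, ht⟩ := F.exists_realizer hL Δ (.atom a)
      exact (hdia _ _ _).2 ⟨t, ⟨Δ, rfl, ht⟩, (ht U).2 h⟩
  | .comp α β, φ, hS', Δ, U, h => by
      have hα := hS _ hS' _ (.comp α β φ)
      have hβ := hS _ hα _ (.mod α _)
      rw [Δ.mem_comp] at h
      rw [DynModel.act, kcomp, PredLift.bind_mem_iff hmor]
      refine act_model_complete α _ hα Δ _ (Δ.mem_mod_mono hL hmono α (fun Δ' h' => ?_) h)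
      rw [F.mem_hat]
      exact act_model_complete β φ hβ Δ' U h'
  | .op f α, φ, hS', Δ, U, h => by
      rw [DynModel.act, PointwiseOp.σ_mem_iff]
      refine (hpos f).eval_mono (fun g hg => ?_) (Δ.mem_op f α |>.1 h)
      refine act_model_complete (α g.1) _ (hS _ hS' _ (.op f α φ g.1 ∅)) Δ _
        ((Δ.mem_mod_congr _ fun Δ' => ?_).1 hg)
      rw [F.mem_hat, Δ'.mem_boolComb]
      simp only [combSet, Set.mem_ofPred_eq, F.mem_hat]
  | .star α, φ, hS', Δ, U, h => by
      have hα := hS _ hS' _ (.star α φ)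
      rw [DynModel.act]
      refine (F.mem_hat {y | kstar (F.model.act θ α) y ∈ lam.app U} Δ).1
        (Δ.mem_of_mem_star α (fun Δ' h' => ?_) h)
      rw [F.mem_hat]
      rcases h' with h' | h'
      · exact kstar_mem_of_step hmor hdia hT _ _ _ (act_model_complete α _ hα Δ' _ h')
      · rw [F.mem_hat] at h'
        exact (kstar_mem_iff hdia _ _ _).2 ⟨0, (PredLift.pure_mem_iff hmor _ _).2 h'⟩
  | .test ψ, φ, hS', Δ, U, h => by
      have hψ := hS _ hS' _ (.test ψ φ)
      rw [Δ.mem_test, F.mem_hat] at h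
      rw [DynModel.act, testAct_mem_iff hmor hdia, truth_model ψ hψ, F.mem_ext _ hψ]
      exact h

/-- True diamonds from the closed set belong to the maximal theories. -/
theorem act_model_sound : ∀ (α : Act P A Sig ar) (φ), .mod α φ ∈ S → ∀ x : X,
    F.model.act θ α x ∈ lam.app (F.ext φ) → x ∈ F.ext (.mod α φ)
  | .atom a, φ, hS', x, h => by
      rw [DynModel.act] at h
      obtain ⟨t, ⟨Δ, rfl, ht⟩, htU⟩ := (hdia _ _ _).1 h
      rw [F.mem_ext _ hS']
      refine (Δ.mem_mod_congr _ fun Δ' => ?_).1 ((ht _).1 htU)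
      rw [F.mem_hat, F.mem_ext _ (hS _ hS' _ (.mod _ φ))]
  | .comp α β, φ, hS', x, h => by
      have hα := hS _ hS' _ (.comp α β φ)
      have hβ := hS _ hα _ (.mod α _)
      rw [DynModel.act, kcomp, PredLift.bind_mem_iff hmor] at h
      have := act_model_sound α _ hα x (hmono _ _ _ (act_model_sound β φ hβ) h)
      obtain ⟨Δ, rfl⟩ := F.surj x
      rwa [F.mem_ext _ hS', Δ.mem_comp, ← F.mem_ext _ hα]
  | .op f α, φ, hS', x, h => by
      have hφ := hS _ hS' _ (.mod _ φ)
      rw [DynModel.act, PointwiseOp.σ_mem_iff] at h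
      obtain ⟨Δ, rfl⟩ := F.surj x
      rw [F.mem_ext _ hS', Δ.mem_op]
      refine (hpos f).eval_mono (fun g hg => ?_) h
      obtain ⟨V', hV'⟩ := exists_boolComb_eq g.2 φ
      have hα := hS _ hS' _ (.op f α φ g.1 V')
      rw [← hV'] at hα
      rw [← F.mem_ext _ hα]
      refine act_model_sound (α g.1) _ hα _ (hmono _ _ _ ?_ hg)
      intro y hy
      obtain ⟨Δ', rfl⟩ := F.surj y
      rw [F.mem_ext _ (hS _ hα _ (.mod _ _)), Δ'.mem_boolComb]
      simpa only [combSet, Set.mem_ofPred_eq, F.mem_ext _ hφ] using hy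
  | .star α, φ, hS', x, h => by
      have hφ := hS _ hS' _ (.mod _ φ)
      have hα := hS _ hS' _ (.star α φ)
      rw [DynModel.act] at h
      obtain ⟨n, h⟩ := (kstar_mem_iff hdia _ _ _).1 h
      induction n generalizing x with
      | zero =>
        obtain ⟨Δ, rfl⟩ := F.surj x
        have := (PredLift.pure_mem_iff hmor _ _).1 h
        rw [F.mem_ext _ hφ] at this
        rw [F.mem_ext _ hS', Δ.mem_star]
        exact .inl this
      | succ n ih =>
        have h' := (PredLift.bind_mem_iff hmor _ _ _).1 h
        have := act_model_sound α _ hα x (hmono _ _ _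
          (fun y hy => ih y ((kstar_mem_iff hdia _ _ _).2 ⟨n, hy⟩) hy) h')
        obtain ⟨Δ, rfl⟩ := F.surj x
        rw [F.mem_ext _ hα] at this
        rw [F.mem_ext _ hS', Δ.mem_star]
        exact .inr this
  | .test ψ, φ, hS', x, h => by
      have hψ := hS _ hS' _ (.test ψ φ)
      have hφ := hS _ hS' _ (.mod _ φ)
      rw [DynModel.act, testAct_mem_iff hmor hdia, truth_model ψ hψ] at h
      obtain ⟨Δ, rfl⟩ := F.surj x
      rw [F.mem_ext _ hψ, F.mem_ext _ hφ] at h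
      rwa [F.mem_ext _ hS', Δ.mem_test]

end

end Filtration

end Theories

end CDL

theorem mainTheorem1
    {T : Type u → Type u} [Monad T] [LawfulMonad T]
    [∀ X : Type u, CompleteSemilatticeSup (T X)]
    (hT : CDL.LeftQuantalic T)
    (lam : CDL.PredLift T)
    (hmono : lam.Monotonic)
    (hdia : lam.DiamondLike)
    (hmor : CDL.IsMonadMorphism (T := T) (T' := CDL.Nbhd) lam.transpose)
    {P A Sig : Type v} [Infinite P]
    (ar : Sig → ℕ)
    (θ : ∀ s : Sig, CDL.PointwiseOp lam (ar s))
    (hpos : ∀ s : Sig, (θ s).Positive)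
    (L : CDL.BaseLogic P)
    (hL : L.OneStepComplete lam) :
    ∀ φ : CDL.Fm P A Sig ar, CDL.DynConsistent L θ φ → CDL.DynSatisfiable θ φ := by
  intro φ hφ
  obtain ⟨Δ, hΔ⟩ := CDL.MaxTheory.exists_not_mem hφ
  rw [Δ.mem_neg, not_not] at hΔ
  obtain ⟨S, hfin, hS, hcl⟩ := CDL.Fm.exists_finite_closed φ
  obtain ⟨X, _, ⟨F⟩⟩ := CDL.exists_filtration A L θ hfin
  refine ⟨X, F.model, F.proj Δ, ?_⟩
  rw [F.truth_model hT hmono hdia hmor hpos hL hcl φ hS]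
  exact (F.mem_ext φ hS Δ).2 hΔ
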